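/- Let $\mathcal A$ be a unital $*$-algebra over $\mathbb C$, let $\mathcal H$ be a complex Hilbert space, $\mathcal L(\mathcal H)$ the bounded operators on $\mathcal H$, and let $T:\mathcal A\to\mathcal L(\mathcal H)$ be a linear hermitian map, i.e. $T(a^*)=T(a)^*$ for all $a\in\mathcal A$. Put $K_T(x,y)=T(xy^*)$ and $\varphi(a,x)=xa^*$ for $a,x,y\in\mathcal A$. An $\mathcal L(\mathcal H)$-valued kernel on $\mathcal A$ is a map $K:\mathcal A\times\mathcal A\to\mathcal L(\mathcal H)$; it is hermitian if $K(x,y)=K(y,x)^*$ for all $x,y$. For finitely supported functions $f,g:\mathcal A\to\mathcal H$ put $[f,g]_K=\sum_{x,y\in\mathcal A}\langle K(x,y)f(y),g(x)\rangle$. For hermitian kernels $K_1,K_2$, write $K_1\le K_2$ if $[f,f]_{K_1}\le[f,f]_{K_2}$ for all such $f$. A hermitian kernel $L$ is positive definite if $[f,f]_L\ge 0$ for all $f$. For $\xi\in\mathcal H$ and $x\in\mathcal A$ let $\xi_x$ be the function with value $\xi$ at $x$ and $0$ elsewhere, and for $a\in\mathcal A$ let $\psi_a$ be the linear map on the finitely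 supported functions with $\psi_a(\xi_x)=\xi_{\varphi(a,x)}$. A positive definite kernel $L$ is $\varphi$-bounded if for every $a\in\mathcal A$ there is a constant $C$ with $[\psi_af,\psi_af]_L^{1/2}\le C\,[f,f]_L^{1/2}$ for all $f$. A Kreĭn space with fundamental symmetry $J$ is a complex Hilbert space $(\mathcal K,\langle\cdot,\cdot\rangle)$ with a bounded operator $J=J^*=J^{-1}$, equipped with the indefinite inner product $[\xi,\eta]=\langle J\xi,\eta\rangle$. A minimal Stinespring dilation of $T$ is a triple $(\pi,\mathcal K,B)$, where $\mathcal K$ is a Kreĭn space with a fundamental symmetry $J$, $B:\mathcal H\to\mathcal K$ is a bounded linear operator, and $\pi:\mathcal A\to\mathcal L(\mathcal K)$ is a unital algebra homomorphism, such that $\pi(a^*)=J\pi(a)^*J$ and $T(a)=B^*J\pi(a)B$ for all $a\in\mathcal A$, and the linear span of $\{\pi(a)B\xi: a\in\mathcal A,\ \xi\in\mathcal H\}$ is dense in $\mathcal K$. (Here $B^*$ and $\pi(a)^*$ are Hilbert space adjoints.) Then the following assertions are equivalent: (1) there exists a $\varphi$-bounded positive definite kernel $L:\mathcal A\times\mathcal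 A\to\mathcal L(\mathcal H)$ such that $-L\le K_T\le L$; (2) $T$ has a minimal Stinespring dilation. -/

import Mathlib

universe u v w

namespace KreinDilation

noncomputable section

open ContinuousLinearMap

/-! ### Operator valued hermitian kernels -/

section Kernels

variable {X : Type u} {S : Type w} {H : Type v}
  [NormedAddCommGroup H] [InnerProductSpace ℂ H] [CompleteSpace H]

/-- A kernel on `X` with values in the bounded operators on `H`. -/
abbrev OpKernel (X : Type u) (H : Type v) [NormedAddCommGroup H] [InnerProductSpace ℂ H] :
    Type (max u v) :=
  X → X → (H →L[ℂ] H)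

/-- The kernel `K` is hermitian: `K(x,y) = K(y,x)^*`. -/
def OpKernel.IsHermitian (K : OpKernel X H) : Prop :=
  ∀ x y, K x y = adjoint (K y x)

/-- The inner product `[f,g]_K = ∑_{x,y} ⟨K(x,y) f(y), g(x)⟩` on the space of finitely supported
functions `X → H`. It is linear in `f` and conjugate linear in `g`; Mathlib's inner product
`inner ℂ a b` is linear in `b`, whence the order of its arguments. -/
def OpKernel.form (K : OpKernel X H) (f g : X →₀ H) : ℂ :=
  ∑ x ∈ g.support, ∑ y ∈ f.support, inner ℂ (g x) (K x y (f y))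

/-- For a hermitian kernel the numbers `[f,f]_K` are real. -/
theorem OpKernel.IsHermitian.form_self_im {K : OpKernel X H} (hK : K.IsHermitian)
    (f : X →₀ H) : (K.form f f).im = 0 := by
  rw [← Complex.conj_eq_iff_im]
  unfold OpKernel.form
  simp only [map_sum, inner_conj_symm]
  rw [Finset.sum_comm]
  refine Finset.sum_congr rfl fun x _ => Finset.sum_congr rfl fun y _ => ?_
  rw [hK y x, adjoint_inner_left]

/-- The order on hermitian kernels: `A ≤ B` if `[f,f]_A ≤ [f,f]_B` for all `f`. For hermitian
kernels these numbers are real, by `OpKernel.IsHermitian.form_self_im`. -/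
def OpKernel.Le (A B : OpKernel X H) : Prop :=
  ∀ f : X →₀ H, (A.form f f).re ≤ (B.form f f).re

/-- A positive definite kernel: a hermitian kernel whose inner product is positive. -/
structure OpKernel.IsPosDef (L : OpKernel X H) : Prop where
  isHermitian : L.IsHermitian
  form_nonneg : ∀ f : X →₀ H, 0 ≤ (L.form f f).re

/-- The seminorm `[f,f]_L^{1/2}` of a positive definite kernel `L`. -/
def OpKernel.seminorm (L : OpKernel X H) (f : X →₀ H) : ℝ :=
  Real.sqrt (L.form f f).re

/-- The linear map `ψ_a` on finitely supported functions with `ψ_a(ξ_x) = ξ_{φ(a,x)}`, where `ξ_x`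
is the function with the value `ξ` at `x` and `0` elsewhere. -/
def translation (H : Type v) [NormedAddCommGroup H] [InnerProductSpace ℂ H]
    (φ : S → X → X) (a : S) : (X →₀ H) →ₗ[ℂ] (X →₀ H) :=
  Finsupp.lmapDomain H ℂ (φ a)

theorem translation_single (φ : S → X → X) (a : S) (x : X) (ξ : H) :
    translation H φ a (Finsupp.single x ξ) = Finsupp.single (φ a x) ξ := by
  simp [translation]

/-- `L` is `φ`-bounded: every `ψ_a` is bounded for the seminorm of `L`. -/
def OpKernel.IsBoundedFor (φ : S → X → X) (L : OpKernel X H) : Prop :=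
  ∀ a : S, ∃ C : ℝ, ∀ f : X →₀ H, L.seminorm (translation H φ a f) ≤ C * L.seminorm f

/-- The set `B_φ^+(X,H)` of positive definite `φ`-bounded kernels. -/
def boundedPosDefKernels (H : Type v) [NormedAddCommGroup H] [InnerProductSpace ℂ H]
    [CompleteSpace H] (φ : S → X → X) : Set (OpKernel X H) :=
  {L | L.IsPosDef ∧ L.IsBoundedFor φ}

end Kernels

/-! ### Kreĭn spaces -/

/-- A Kreĭn space with a fundamental symmetry `J`: a Hilbert space `K` with a symmetry
`J = J^* = J⁻¹`. The indefinite inner product is `KreinSpace.form`. -/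
class KreinSpace (K : Type w) [NormedAddCommGroup K] [InnerProductSpace ℂ K]
    [CompleteSpace K] where
  J : K →L[ℂ] K
  adjoint_J : adjoint J = J
  J_comp_J : J ∘L J = ContinuousLinearMap.id ℂ K

namespace KreinSpace

variable {K : Type w} [NormedAddCommGroup K] [InnerProductSpace ℂ K] [CompleteSpace K]
  [KreinSpace K]

/-- The indefinite inner product `[ξ,η] = ⟨Jξ,η⟩`. -/
def form (ξ η : K) : ℂ := inner ℂ η (J ξ)

/-- The adjoint `A^♯ = J A^* J` for the indefinite inner product. -/
def sharp (A : K →L[ℂ] K) : K →L[ℂ] K := J ∘L adjoint A ∘L J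

theorem form_sharp (A : K →L[ℂ] K) (ξ η : K) : form (A ξ) η = form ξ (sharp A η) := by
  have hJ : ∀ x y : K, inner ℂ (J x) y = inner ℂ x (J y) := fun x y => by
    conv_lhs => rw [← adjoint_J (K := K)]
    rw [adjoint_inner_left]
  have hJJ : ∀ x : K, J (J x) = x := fun x => by
    have := congrArg (fun F : K →L[ℂ] K => F x) (J_comp_J (K := K))
    simpa using this
  simp only [form, sharp, ContinuousLinearMap.comp_apply]
  rw [hJ, hJJ, adjoint_inner_left, hJ]

end KreinSpace

/-! ### Stinespring dilations of hermitian maps -/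

section Stinespring

variable {A : Type u} [Ring A] [StarRing A] [Algebra ℂ A] [StarModule ℂ A]
  {H : Type v} [NormedAddCommGroup H] [InnerProductSpace ℂ H] [CompleteSpace H]

/-- The linear map `T` is hermitian: `T(a^*) = T(a)^*`. -/
def IsHermitianMap (T : A →ₗ[ℂ] (H →L[ℂ] H)) : Prop :=
  ∀ a, T (star a) = adjoint (T a)

/-- The action `φ(a,x) = x a^*` of the multiplicative semigroup of `A` on `A`. -/
def starAction (a x : A) : A := x * star a

theorem starAction_one (x : A) : starAction 1 x = x := by
  simp [starAction]

theorem starAction_mul (a b x : A) :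
    starAction (a * b) x = starAction a (starAction b x) := by
  simp [starAction, mul_assoc]

/-- The kernel `K_T(x,y) = T(x y^*)`. -/
def kernelOf (T : A →ₗ[ℂ] (H →L[ℂ] H)) : OpKernel A H :=
  fun x y => T (x * star y)

theorem kernelOf_isHermitian {T : A →ₗ[ℂ] (H →L[ℂ] H)} (hT : IsHermitianMap T) :
    (kernelOf T).IsHermitian := by
  intro x y
  simp only [kernelOf]
  rw [← hT]
  simp

/-- A Stinespring dilation `(π, K, B)` of `T` on the Kreĭn space `K` with fundamental
symmetry `J`. -/
structure StinespringDilation (T : A →ₗ[ℂ] (H →L[ℂ] H)) (K : Type w) [NormedAddCommGroup K]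
    [InnerProductSpace ℂ K] [CompleteSpace K] [KreinSpace K] where
  B : H →L[ℂ] K
  rep : A →ₐ[ℂ] (K →L[ℂ] K)
  rep_star : ∀ a, rep (star a) = KreinSpace.sharp (rep a)
  dilates : ∀ a, T a = adjoint B ∘L KreinSpace.J ∘L rep a ∘L B

/-- The dilation is minimal: the vectors `π(a) B ξ` are total in `K`. -/
def StinespringDilation.IsMinimal {T : A →ₗ[ℂ] (H →L[ℂ] H)} {K : Type w}
    [NormedAddCommGroup K] [InnerProductSpace ℂ K] [CompleteSpace K] [KreinSpace K]
    (D : StinespringDilation T K) : Prop :=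
  (Submodule.span ℂ {k : K | ∃ (a : A) (ξ : H), k = D.rep a (D.B ξ)}).topologicalClosure = ⊤

/-- `T` has a minimal Stinespring dilation. By minimality the cardinality of the Kreĭn space is
bounded in terms of `A` and `H`, so it may be taken in the universe of `A` and `H`. -/
def HasMinimalStinespringDilation (T : A →ₗ[ℂ] (H →L[ℂ] H)) : Prop :=
  ∃ (K : Type (max u v)) (_ : NormedAddCommGroup K) (_ : InnerProductSpace ℂ K)
    (_ : CompleteSpace K) (_ : KreinSpace K) (D : StinespringDilation T K), D.IsMinimal

end Stinespring

end

end KreinDilation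

namespace KreinDilation

open ContinuousLinearMap

/-! From (1) to (2): `L` yields a Hilbert space `F` with a dense map `κ` from the finitely supported
functions, and `-L ≤ K_T ≤ L` turns `K_T` into a bounded selfadjoint `G` on `F`. Writing `G = J|G|`,
the Kreĭn space is the closed range of `|G|^{1/2}` with `J` restricted to it. By `φ`-boundedness
`ψ_a` extends to `U a` on `F`. The crux is that `U a` stays bounded in the weaker seminorm
`‖|G|^{1/2} ·‖`; this follows from `G * U a = adjoint (U (star a)) * G` by
`exists_norm_sqrt_abs_apply_le`, which rests on Reid's inequality. The induced operators form `π`,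
and `B ξ` is the class of `ξ_1`.

From (2) to (1): omitting `J` from the dilation formula for `K_T` gives `L`, and Cauchy–Schwarz
gives the domination because `J` is isometric. -/

theorem le_mul_of_sq_le_mul_of_le_geometric {a : ℕ → ℝ} (ha : ∀ n, 0 ≤ a n)
    (hconv : ∀ n, a (n + 1) ^ 2 ≤ a n * a (n + 2)) {C c : ℝ} (hc : 0 < c)
    (hbound : ∀ n, a n ≤ C * c ^ n) : a 1 ≤ c * a 0 := by
  by_contra! hlt
  have h0 : 0 < a 0 := by
    refine (ha 0).lt_of_ne fun h => ?_
    have h1 := hconv 0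
    rw [← h, zero_mul] at h1
    rw [← h, mul_zero] at hlt
    nlinarith
  set r := a 1 / a 0 with hr
  have hcr : c < r := by rwa [hr, lt_div_iff₀ h0]
  have hr0 : 0 < r := hc.trans hcr
  -- Log-convexity makes the successive ratios nondecreasing, so all are at least `r > c`; growth
  -- like `r ^ n` then contradicts `hbound`.
  have hstep : ∀ n, 0 < a n ∧ r * a n ≤ a (n + 1) := by
    intro n
    induction n with
    | zero => exact ⟨h0, by rw [hr, div_mul_cancel₀ _ h0.ne']⟩
    | succ n ih =>
      have h1 : 0 < a (n + 1) := (mul_pos hr0 ih.1).trans_le ih.2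
      refine ⟨h1, ?_⟩
      have h2 := hconv n
      have h3 : r * a n * a (n + 1) ≤ a n * a (n + 2) := by nlinarith
      nlinarith [ih.1]
  have hgeom : ∀ n, r ^ n * a 0 ≤ a n := by
    intro n
    induction n with
    | zero => simp
    | succ n ih =>
      calc r ^ (n + 1) * a 0 = r * (r ^ n * a 0) := by ring
        _ ≤ r * a n := by gcongr
        _ ≤ a (n + 1) := (hstep n).2
  obtain ⟨n, hn⟩ := pow_unbounded_of_one_lt (C / a 0) ((one_lt_div hc).2 hcr)
  rw [div_pow, div_lt_div_iff₀ h0 (by positivity)] at hn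
  linarith [hgeom n, hbound n]

/-! ### Symmetrizable operators and induced Kreĭn spaces -/

section Operators

variable {E : Type w} [NormedAddCommGroup E] [InnerProductSpace ℂ E] [CompleteSpace E]

/-- `J` is the reflection in the closed range of `G⁺`; the range of `G⁻` is orthogonal to it. On the
kernel of `G` it acts as `-1`, so `J` is a genuine symmetry even if `G` is not injective. -/
theorem exists_isSelfAdjoint_mul_self_mul_abs_eq (G : E →L[ℂ] E) (hG : IsSelfAdjoint G) :
    ∃ J : E →L[ℂ] E, IsSelfAdjoint J ∧ J * J = 1 ∧ J * CFC.abs G = G := by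
  set M : Submodule ℂ E := (LinearMap.range ((G⁺ : E →L[ℂ] E) : E →ₗ[ℂ] E)).topologicalClosure
  have hcomp : CompleteSpace M := (Submodule.isClosed_topologicalClosure _).completeSpace_coe
  have hpos : IsSelfAdjoint (G⁺) := (CFC.posPart_nonneg G).isSelfAdjoint
  refine ⟨(M.reflection.toContinuousLinearEquiv : E →L[ℂ] E), ?_, ?_, ?_⟩
  · rw [isSelfAdjoint_iff_isSymmetric]
    intro x y
    change inner ℂ (M.reflection x) y = inner ℂ x (M.reflection y)
    rw [← M.reflection.inner_map_map, M.reflection_reflection]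
  · ext x
    simp
  · have h1 : ∀ x, M.reflection (G⁺ x) = G⁺ x := fun x =>
      Submodule.reflection_mem_subspace_eq_self
        (Submodule.le_topologicalClosure _ (LinearMap.mem_range_self ((G⁺ : E →L[ℂ] E) : E →ₗ[ℂ] E) x))
    have h2 : ∀ x, M.reflection (G⁻ x) = - G⁻ x := fun x => by
      refine Submodule.reflection_mem_subspace_orthogonalComplement_eq_neg ?_
      rw [Submodule.orthogonal_closure]
      rw [Submodule.mem_orthogonal]
      rintro _ ⟨y, rfl⟩
      have h3 : G⁺ (G⁻ x) = 0 := 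
        congrArg (fun F : E →L[ℂ] E => F x) (CFC.posPart_mul_negPart G)
      calc inner ℂ (G⁺ y) (G⁻ x) = inner ℂ y (G⁺ (G⁻ x)) :=
            (isSelfAdjoint_iff_isSymmetric.1 hpos) y (G⁻ x)
        _ = 0 := by rw [h3, inner_zero_right]
    ext x
    rw [← CFC.posPart_add_negPart G hG]
    conv_rhs => rw [← CFC.posPart_sub_negPart G hG]
    simp [h1, h2, sub_eq_add_neg]

/-- **Reid's inequality**: an operator which is symmetric for the semi-inner product
`⟨R² ·, ·⟩` is bounded for it. -/
theorem exists_norm_apply_le_of_isSelfAdjoint_mul {R M : E →L[ℂ] E} (hR : IsSelfAdjoint R)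
    (hM : IsSelfAdjoint (R * R * M)) : ∃ C : ℝ, ∀ x, ‖R (M x)‖ ≤ C * ‖R x‖ := by
  -- The sequence `‖R (M ^ n x)‖ ^ 2` is log-convex and grows at most like `‖M‖ ^ (2 * n)`; the `+
  -- 1` keeps the ratio positive when `M = 0`.
  refine ⟨√(‖M‖ ^ 2 + 1), fun x => ?_⟩
  have hRs : ∀ x y, inner ℂ (R x) y = inner ℂ x (R y) := isSelfAdjoint_iff_isSymmetric.1 hR
  have hMs : ∀ x y, inner ℂ (R (R (M x))) y = inner ℂ x (R (R (M y))) :=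
    isSelfAdjoint_iff_isSymmetric.1 hM
  have key : ∀ x, ‖R (M x)‖ ^ 2 ≤ ‖R x‖ * ‖R (M (M x))‖ := fun x => by
    have h : inner ℂ (R (M x)) (R (M x)) = inner ℂ (R x) (R (M (M x))) := by
      rw [← hRs, hMs, ← hRs]
    rw [← inner_self_eq_norm_sq (𝕜 := ℂ), h]
    exact (RCLike.re_le_norm _).trans (norm_inner_le_norm _ _)
  have hpow : ∀ n, ‖(M ^ n) x‖ ≤ ‖M‖ ^ n * ‖x‖ := by
    intro n
    induction n with
    | zero => simp
    | succ n ih =>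
      rw [pow_succ', pow_succ']
      calc ‖M ((M ^ n) x)‖ ≤ ‖M‖ * ‖(M ^ n) x‖ := M.le_opNorm _
        _ ≤ ‖M‖ * (‖M‖ ^ n * ‖x‖) := by gcongr
        _ = _ := by ring
  have h := le_mul_of_sq_le_mul_of_le_geometric (a := fun n => ‖R ((M ^ n) x)‖ ^ 2)
    (C := ‖R‖ ^ 2 * ‖x‖ ^ 2) (c := ‖M‖ ^ 2 + 1) (fun n => by positivity)
    (fun n => ?_) (by positivity) (fun n => ?_)
  · have h' : ‖R (M x)‖ ^ 2 ≤ (‖M‖ ^ 2 + 1) * ‖R x‖ ^ 2 := by simpa using h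
    refine (abs_le_of_sq_le_sq' ?_ (by positivity)).2
    rwa [mul_pow, Real.sq_sqrt (by positivity)]
  · have := key ((M ^ n) x)
    have e1 : (M ^ (n + 1)) x = M ((M ^ n) x) := by rw [pow_succ']; rfl
    have e2 : (M ^ (n + 2)) x = M (M ((M ^ n) x)) := by rw [pow_succ', pow_succ']; rfl
    simp only [e1, e2]
    rw [← mul_pow]
    gcongr
  · calc ‖R ((M ^ n) x)‖ ^ 2 ≤ (‖R‖ * (‖M‖ ^ n * ‖x‖)) ^ 2 := by
          gcongr
          exact (R.le_opNorm _).trans (by gcongr; exact hpow n)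
      _ = ‖R‖ ^ 2 * ‖x‖ ^ 2 * (‖M‖ ^ 2) ^ n := by ring
      _ ≤ _ := by gcongr; linarith

/-- A lifting theorem of Krein, Lax and Dieudonné for the semi-inner product given by the absolute
value of `G`. -/
theorem exists_norm_sqrt_abs_apply_le {G U W : E →L[ℂ] E} (hG : IsSelfAdjoint G)
    (h : G * U = W * G) :
    ∃ C : ℝ, ∀ x, ‖CFC.sqrt (CFC.abs G) (U x)‖ ≤ C * ‖CFC.sqrt (CFC.abs G) x‖ := by
  obtain ⟨J, hJ, hJJ, hJG⟩ := exists_isSelfAdjoint_mul_self_mul_abs_eq G hG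
  set P := CFC.abs G with hP
  set R := CFC.sqrt P with hRdef
  have hR : IsSelfAdjoint R := (CFC.sqrt_nonneg P).isSelfAdjoint
  have hRR : R * R = P := CFC.sqrt_mul_sqrt_self P (CFC.abs_nonneg G)
  have hPs : IsSelfAdjoint P := (CFC.abs_nonneg G).isSelfAdjoint
  have hJG' : J * G = P := by rw [← hJG, ← mul_assoc, hJJ, one_mul]
  have hPU : P * U = J * W * J * P := by
    rw [← hJG', mul_assoc J G U, h]
    simp only [mul_assoc]
    rw [← mul_assoc J J G, hJJ, one_mul]
  -- Taking adjoints in `hPU` gives `P * M = star U * P * U`, so `M` plays the role of `U^♯U` for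
  -- the semi-inner product of `P`: it is symmetric there, and `‖R (U x)‖ ^ 2 = ⟨R x, R (M x)⟩`.
  set M := star (star U * (J * W * J)) with hM
  have hPM : R * R * M = star U * P * U := by
    have e : star U * P * U = star U * (J * W * J) * P := by
      rw [mul_assoc, hPU]; simp only [mul_assoc]
    have e' := congrArg star e
    rw [star_mul, star_mul (star U) P, star_star, hPs.star_eq, star_mul _ P, hPs.star_eq,
      ← mul_assoc] at e'
    rw [hRR, hM, e']
  obtain ⟨C, hC⟩ := exists_norm_apply_le_of_isSelfAdjoint_mul (R := R) (M := M) hR (by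
    rw [hPM, isSelfAdjoint_iff, star_mul, star_mul, star_star, hPs.star_eq, mul_assoc])
  refine ⟨√|C|, fun x => ?_⟩
  refine (abs_le_of_sq_le_sq' ?_ (by positivity)).2
  rw [mul_pow, Real.sq_sqrt (abs_nonneg C)]
  have hRs : ∀ x y, inner ℂ (R x) y = inner ℂ x (R y) := isSelfAdjoint_iff_isSymmetric.1 hR
  have h1 : inner ℂ (R (U x)) (R (U x)) = inner ℂ (R x) (R (M x)) := by
    have h2 : R (R (M x)) = adjoint U (P (U x)) := by
      exact congrArg (fun F : E →L[ℂ] E => F x) hPM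
    have h3 : R (R (U x)) = P (U x) := by
      simpa using congrArg (fun F : E →L[ℂ] E => F (U x)) hRR
    rw [hRs, hRs, h2, h3, adjoint_inner_right]
  rw [← inner_self_eq_norm_sq (𝕜 := ℂ), h1]
  calc _ ≤ ‖R x‖ * ‖R (M x)‖ := (RCLike.re_le_norm _).trans (norm_inner_le_norm _ _)
    _ ≤ ‖R x‖ * (|C| * ‖R x‖) := by
      gcongr
      exact (hC x).trans (by gcongr; exact le_abs_self C)
    _ = _ := by ring

/-- The Kreĭn space induced by a selfadjoint operator. -/
theorem exists_kreinSpace_of_isSelfAdjoint (G : E →L[ℂ] E) (hG : IsSelfAdjoint G) :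
    ∃ (K : Type w) (_ : NormedAddCommGroup K) (_ : InnerProductSpace ℂ K)
      (_ : CompleteSpace K) (_ : KreinSpace K) (Q : E →L[ℂ] K),
      DenseRange Q ∧
      (∀ x y, inner ℂ (Q x) (KreinSpace.J (Q y)) = inner ℂ x (G y)) ∧
      ∀ U W : E →L[ℂ] E, G * U = W * G → ∃ C : ℝ, ∀ x, ‖Q (U x)‖ ≤ C * ‖Q x‖ := by
  obtain ⟨J, hJ, hJJ, hJG⟩ := exists_isSelfAdjoint_mul_self_mul_abs_eq G hG
  have hbd := fun U W : E →L[ℂ] E => exists_norm_sqrt_abs_apply_le (U := U) (W := W) hG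
  have hPs : IsSelfAdjoint (CFC.abs G) := (CFC.abs_nonneg G).isSelfAdjoint
  have hcomm : Commute (CFC.abs G) J := by
    have := congrArg star hJG
    rw [star_mul, hJ.star_eq, hPs.star_eq, hG.star_eq] at this
    rw [commute_iff_eq, this, hJG]
  have hRJ : Commute (CFC.sqrt (CFC.abs G)) J := by
    rw [CFC.sqrt]
    exact hcomm.cfcₙ_nnreal _
  set R := CFC.sqrt (CFC.abs G) with hRdef
  have hR : IsSelfAdjoint R := (CFC.sqrt_nonneg _).isSelfAdjoint
  have hRR : R * R = CFC.abs G := CFC.sqrt_mul_sqrt_self _ (CFC.abs_nonneg G)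
  have hRs : ∀ x y, inner ℂ (R x) y = inner ℂ x (R y) := isSelfAdjoint_iff_isSymmetric.1 hR
  have hJs : ∀ x y, inner ℂ (J x) y = inner ℂ x (J y) := isSelfAdjoint_iff_isSymmetric.1 hJ
  have hRJ' : ∀ x, R (J x) = J (R x) := fun x => congrArg (fun F : E →L[ℂ] E => F x) hRJ.eq
  -- `J` commutes with `R`, hence preserves this space and restricts to a symmetry of it.
  set S : Submodule ℂ E := (LinearMap.range (R : E →ₗ[ℂ] E)).topologicalClosure with hS
  have hSc : CompleteSpace S := (Submodule.isClosed_topologicalClosure _).completeSpace_coe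
  have hRS : ∀ x, R x ∈ S := fun x =>
    Submodule.le_topologicalClosure _ (LinearMap.mem_range_self (R : E →ₗ[ℂ] E) x)
  have hJS : ∀ x ∈ S, J x ∈ S := by
    intro x hx
    refine map_mem_closure J.continuous hx ?_
    rintro _ ⟨y, rfl⟩
    exact ⟨J y, hRJ' y⟩
  let JS : S →L[ℂ] S := (J.comp S.subtypeL).codRestrict S fun x => hJS x x.2
  refine ⟨S, inferInstance, inferInstance, hSc, ⟨JS, ?_, ?_⟩, R.codRestrict S hRS, ?_, ?_, ?_⟩
  · have : IsSelfAdjoint JS := by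
      rw [isSelfAdjoint_iff_isSymmetric]
      intro x y
      exact hJs x y
    exact this
  · ext x
    exact congrArg (fun F : E →L[ℂ] E => F x) hJJ
  · intro x
    rw [closure_subtype]
    have : ((↑) '' Set.range (R.codRestrict S hRS) : Set E) = Set.range R := by
      rw [← Set.range_comp]; rfl
    rw [this]
    exact x.2
  · intro x y
    change inner ℂ (R x) (J (R y)) = _
    rw [hRs, ← hRJ']
    rw [hRJ', hRJ']
    have h1 : R (R y) = CFC.abs G y := congrArg (fun F : E →L[ℂ] E => F y) hRR
    have h2 : J (CFC.abs G y) = G y := congrArg (fun F : E →L[ℂ] E => F y) hJG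
    rw [h1, h2]
  · exact hbd

/-- The Hilbert space induced by a semi-inner product. -/
theorem exists_denseRange_inner_eq {V : Type w} [AddCommGroup V] [Module ℂ V]
    (c : PreInnerProductSpace.Core ℂ V) :
    ∃ (F : Type w) (_ : NormedAddCommGroup F) (_ : InnerProductSpace ℂ F)
      (_ : CompleteSpace F) (κ : V →ₗ[ℂ] F),
      DenseRange κ ∧ ∀ f g, inner ℂ (κ f) (κ g) = c.inner f g := by
  let _ : SeminormedAddCommGroup V := InnerProductSpace.Core.toSeminormedAddCommGroup (𝕜 := ℂ)
  let _ : InnerProductSpace ℂ V := .ofCore c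
  refine ⟨UniformSpace.Completion V, inferInstance, inferInstance, inferInstance,
    (UniformSpace.Completion.toComplL : V →L[ℂ] UniformSpace.Completion V), ?_, ?_⟩
  · exact UniformSpace.Completion.denseRange_coe
  · intro f g
    exact UniformSpace.Completion.inner_coe f g

end Operators

/-! ### Kernel forms and Gram operators -/

section Forms

variable {X : Type u} {H : Type v} [NormedAddCommGroup H] [InnerProductSpace ℂ H]

theorem OpKernel.form_eq_sum (K : OpKernel X H) (f g : X →₀ H) :
    K.form f g = g.sum fun x η => f.sum fun y ξ => inner ℂ η (K x y ξ) := rfl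

theorem OpKernel.form_eq_sum' (K : OpKernel X H) (f g : X →₀ H) :
    K.form f g = f.sum fun y ξ => g.sum fun x η => inner ℂ η (K x y ξ) := by
  rw [form_eq_sum, Finsupp.sum_comm]

theorem OpKernel.form_add_left (K : OpKernel X H) (f f' g : X →₀ H) :
    K.form (f + f') g = K.form f g + K.form f' g := by
  simp only [form_eq_sum']
  rw [Finsupp.sum_add_index'] <;> simp

theorem OpKernel.form_add_right (K : OpKernel X H) (f g g' : X →₀ H) :
    K.form f (g + g') = K.form f g + K.form f g' := by
  simp only [form_eq_sum]
  rw [Finsupp.sum_add_index'] <;> simp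

theorem OpKernel.form_smul_right (K : OpKernel X H) (c : ℂ) (f g : X →₀ H) :
    K.form f (c • g) = starRingEnd ℂ c * K.form f g := by
  simp only [form_eq_sum]
  rw [Finsupp.sum_smul_index'] <;> simp [Finsupp.sum, Finset.sum_mul, mul_comm (starRingEnd ℂ c)]

theorem OpKernel.form_single (K : OpKernel X H) (x y : X) (ξ η : H) :
    K.form (Finsupp.single y ξ) (Finsupp.single x η) = inner ℂ η (K x y ξ) := by
  simp [form_eq_sum]

theorem OpKernel.form_add (K L : OpKernel X H) (f g : X →₀ H) :
    OpKernel.form (K + L) f g = K.form f g + L.form f g := by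
  simp [OpKernel.form, Finset.sum_add_distrib]

theorem OpKernel.form_neg (K : OpKernel X H) (f g : X →₀ H) :
    OpKernel.form (-K) f g = -K.form f g := by
  simp [OpKernel.form]

theorem OpKernel.form_sub (K L : OpKernel X H) (f g : X →₀ H) :
    OpKernel.form (K - L) f g = K.form f g - L.form f g := by
  rw [sub_eq_add_neg, form_add, form_neg, sub_eq_add_neg]

variable [CompleteSpace H]

theorem OpKernel.IsHermitian.conj_form {K : OpKernel X H} (hK : K.IsHermitian)
    (f g : X →₀ H) : starRingEnd ℂ (K.form f g) = K.form g f := by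
  rw [OpKernel.form_eq_sum, OpKernel.form_eq_sum']
  simp only [Finsupp.sum, map_sum, inner_conj_symm]
  refine Finset.sum_congr rfl fun x _ => Finset.sum_congr rfl fun y _ => ?_
  rw [hK x y, adjoint_inner_left]

/-- The Kolmogorov decomposition of a positive definite kernel. -/
theorem OpKernel.IsPosDef.exists_inner_eq_form {L : OpKernel X H} (hL : L.IsPosDef) :
    ∃ (F : Type (max u v)) (_ : NormedAddCommGroup F) (_ : InnerProductSpace ℂ F)
      (_ : CompleteSpace F) (κ : (X →₀ H) →ₗ[ℂ] F),
      DenseRange κ ∧ ∀ f g, inner ℂ (κ g) (κ f) = L.form f g := by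
  obtain ⟨F, i1, i2, i3, κ, hκ, h⟩ := exists_denseRange_inner_eq (V := X →₀ H)
    { inner := fun g f => L.form f g
      conj_inner_symm := fun f g => hL.isHermitian.conj_form f g
      re_inner_nonneg := hL.form_nonneg
      add_left := fun f g h => L.form_add_right h f g
      smul_left := fun f g c => L.form_smul_right c g f }
  exact ⟨F, i1, i2, i3, κ, hκ, fun f g => h g f⟩

omit [CompleteSpace H] in
theorem norm_eq_seminorm_of_inner_eq_form {L : OpKernel X H} {F : Type w}
    [NormedAddCommGroup F] [InnerProductSpace ℂ F] {κ : (X →₀ H) →ₗ[ℂ] F}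
    (h : ∀ f g, inner ℂ (κ g) (κ f) = L.form f g) (f : X →₀ H) :
    ‖κ f‖ = L.seminorm f := by
  rw [norm_eq_sqrt_re_inner (𝕜 := ℂ), h]
  rfl

/-- A positive definite kernel dominated by `C² L` has a Gram operator on the Hilbert space
of `L`. -/
theorem OpKernel.IsPosDef.exists_gram {P : OpKernel X H} (hP : P.IsPosDef) {F : Type w}
    [NormedAddCommGroup F] [InnerProductSpace ℂ F] [CompleteSpace F] {κ : (X →₀ H) →ₗ[ℂ] F}
    (hκ : DenseRange κ) {C : ℝ} (hC : ∀ f, P.seminorm f ≤ C * ‖κ f‖) :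
    ∃ G : F →L[ℂ] F, IsSelfAdjoint G ∧ ∀ f g, inner ℂ (κ g) (G (κ f)) = P.form f g := by
  obtain ⟨F', i1, i2, i3, κ', -, h⟩ := hP.exists_inner_eq_form
  have hbd : ∃ C : ℝ, ∀ f, ‖κ' f‖ ≤ C * ‖κ f‖ := ⟨C, fun f => by
    rw [norm_eq_seminorm_of_inner_eq_form h]; exact hC f⟩
  let S : F →L[ℂ] F' := κ'.extendOfNorm κ
  have hS : ∀ f, S (κ f) = κ' f := LinearMap.extendOfNorm_eq hκ hbd
  refine ⟨adjoint S ∘L S, by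
    rw [isSelfAdjoint_iff', adjoint_comp, adjoint_adjoint], fun f g => ?_⟩
  rw [ContinuousLinearMap.comp_apply, adjoint_inner_right, hS, hS, h]

/-- Both `L + K` and `L - K` are positive definite and dominated by `2L`, whence the constant `√2`;
half the difference of their Gram operators represents `K`. -/
theorem OpKernel.IsHermitian.exists_gram {K L : OpKernel X H} (hK : K.IsHermitian)
    (hL : L.IsPosDef) (h1 : OpKernel.Le (-L) K) (h2 : K.Le L) {F : Type w}
    [NormedAddCommGroup F] [InnerProductSpace ℂ F] [CompleteSpace F] {κ : (X →₀ H) →ₗ[ℂ] F}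
    (hκ : DenseRange κ) (h : ∀ f g, inner ℂ (κ g) (κ f) = L.form f g) :
    ∃ G : F →L[ℂ] F, IsSelfAdjoint G ∧ ∀ f g, inner ℂ (κ g) (G (κ f)) = K.form f g := by
  have hle : ∀ f, -(L.form f f).re ≤ (K.form f f).re := fun f => by
    simpa [OpKernel.form_neg] using h1 f
  have hadd : OpKernel.IsPosDef (L + K) :=
    ⟨fun x y => by
      rw [Pi.add_apply, Pi.add_apply, Pi.add_apply, Pi.add_apply, map_add, ← hL.isHermitian, ← hK],
      fun f => by rw [OpKernel.form_add, Complex.add_re]; linarith [hle f]⟩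
  have hsub : OpKernel.IsPosDef (L - K) :=
    ⟨fun x y => by
      rw [Pi.sub_apply, Pi.sub_apply, Pi.sub_apply, Pi.sub_apply, map_sub, ← hL.isHermitian, ← hK],
      fun f => by rw [OpKernel.form_sub, Complex.sub_re]; linarith [h2 f]⟩
  have hn := norm_eq_seminorm_of_inner_eq_form h
  obtain ⟨G, hG, hGf⟩ := hadd.exists_gram hκ (C := √2) fun f => by
    rw [hn, OpKernel.seminorm, OpKernel.seminorm, ← Real.sqrt_mul (by norm_num),
      OpKernel.form_add, Complex.add_re]
    exact Real.sqrt_le_sqrt (by linarith [h2 f])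
  obtain ⟨G', hG', hGf'⟩ := hsub.exists_gram hκ (C := √2) fun f => by
    rw [hn, OpKernel.seminorm, OpKernel.seminorm, ← Real.sqrt_mul (by norm_num),
      OpKernel.form_sub, Complex.sub_re]
    exact Real.sqrt_le_sqrt (by linarith [hle f])
  have hhalf : IsSelfAdjoint (1 / 2 : ℂ) := by simp [isSelfAdjoint_iff]
  refine ⟨(1 / 2 : ℂ) • (G - G'), hhalf.smul (hG.sub hG'), fun f g => ?_⟩
  rw [smul_apply, sub_apply, inner_smul_right, inner_sub_right, hGf, hGf', OpKernel.form_add, OpKernel.form_sub]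
  ring

end Forms

/-! ### From kernels to dilations and back -/

section Dilation

variable {A : Type u} [Ring A] [StarRing A] [Algebra ℂ A] [StarModule ℂ A]
  {H : Type v} [NormedAddCommGroup H] [InnerProductSpace ℂ H] [CompleteSpace H]

omit [StarModule ℂ A] [CompleteSpace H] in
theorem form_translation_left (T : A →ₗ[ℂ] (H →L[ℂ] H)) (a : A) (f g : A →₀ H) :
    (kernelOf T).form (translation H starAction a f) g =
      g.sum fun x η => f.sum fun y ξ => inner ℂ η (T (x * a * star y) ξ) := by
  rw [OpKernel.form_eq_sum]
  simp only [translation, Finsupp.lmapDomain_apply]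
  refine Finsupp.sum_congr fun x _ => ?_
  rw [Finsupp.sum_mapDomain_index (by simp) (by simp)]
  simp [kernelOf, starAction, mul_assoc]

omit [StarModule ℂ A] [CompleteSpace H] in
-- Both sides have the entries `T (x * star a * star y)`. This invariance is the source of `π(a^*) =
-- π(a)^♯`.
theorem form_translation_right (T : A →ₗ[ℂ] (H →L[ℂ] H)) (a : A) (f g : A →₀ H) :
    (kernelOf T).form f (translation H starAction a g) =
      (kernelOf T).form (translation H starAction (star a) f) g := by
  rw [form_translation_left, OpKernel.form_eq_sum]
  simp only [translation, Finsupp.lmapDomain_apply]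
  rw [Finsupp.sum_mapDomain_index (by simp) (by simp [Finsupp.sum_add])]
  simp [kernelOf, starAction, mul_assoc]

omit [CompleteSpace H] in
theorem translation_one (f : A →₀ H) : translation H (starAction (A := A)) 1 f = f := by
  have : starAction (1 : A) = id := funext starAction_one
  simp [translation, this]

omit [CompleteSpace H] in
theorem translation_mul (a b : A) (f : A →₀ H) :
    translation H starAction (a * b) f =
      translation H starAction a (translation H starAction b f) := by
  have : starAction (a * b) = starAction a ∘ starAction b := funext (starAction_mul a b)
  simp [translation, this, Finsupp.mapDomain_comp]

theorem norm_J_apply {K : Type w} [NormedAddCommGroup K]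
    [InnerProductSpace ℂ K] [CompleteSpace K] [KreinSpace K] (x : K) :
    ‖(KreinSpace.J x : K)‖ = ‖x‖ := by
  have h : inner ℂ (KreinSpace.J x : K) (KreinSpace.J x) = inner ℂ x x := by
    rw [← adjoint_inner_right, KreinSpace.adjoint_J]
    have := congrArg (fun F : K →L[ℂ] K => F x) (KreinSpace.J_comp_J (K := K))
    simp only [ContinuousLinearMap.comp_apply, ContinuousLinearMap.id_apply] at this
    rw [this]
  rw [norm_eq_sqrt_re_inner (𝕜 := ℂ), h, ← norm_eq_sqrt_re_inner]

theorem J_apply_J_apply {K : Type w} [NormedAddCommGroup K]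
    [InnerProductSpace ℂ K] [CompleteSpace K] [KreinSpace K] (x : K) :
    KreinSpace.J (KreinSpace.J x) = x :=
  congrArg (fun F : K →L[ℂ] K => F x) (KreinSpace.J_comp_J (K := K))

theorem hasMinimalStinespringDilation_of_denseRange {T : A →ₗ[ℂ] (H →L[ℂ] H)}
    {K : Type (max u v)} [NormedAddCommGroup K] [InnerProductSpace ℂ K] [CompleteSpace K]
    [KreinSpace K] {q : (A →₀ H) →ₗ[ℂ] K} (hq : DenseRange q)
    (hform : ∀ f g, inner ℂ (q g) (KreinSpace.J (q f)) = (kernelOf T).form f g)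
    (hB : ∃ C : ℝ, ∀ ξ, ‖q (Finsupp.single 1 ξ)‖ ≤ C * ‖ξ‖)
    (hbd : ∀ a, ∃ C : ℝ, ∀ f, ‖q (translation H starAction a f)‖ ≤ C * ‖q f‖) :
    HasMinimalStinespringDilation T := by
  -- Nondegeneracy: identities in `K` can be tested against `q g`, where `hform` reduces them to
  -- identities for `K_T`.
  have hext : ∀ x y : K, (∀ g, inner ℂ (q g) (KreinSpace.J x) = inner ℂ (q g) (KreinSpace.J y)) →
      x = y := fun x y h => by
    have h1 : (KreinSpace.J x : K) = KreinSpace.J y := by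
      refine hq.eq_of_inner_right ℂ ?_
      exact h
    rw [← J_apply_J_apply x, h1, J_apply_J_apply]
  let ρ : A → K →L[ℂ] K := fun a => (q ∘ₗ translation H starAction a).extendOfNorm q
  have hρ : ∀ a f, ρ a (q f) = q (translation H starAction a f) := fun a f =>
    LinearMap.extendOfNorm_eq (f := q ∘ₗ translation H starAction a) hq (hbd a) f
  have hρext : ∀ U V : K →L[ℂ] K, (∀ f, U (q f) = V (q f)) → U = V := fun U V h =>
    ContinuousLinearMap.coeFn_injective
      (hq.equalizer U.continuous V.continuous (funext h))
  let ρl : A →ₗ[ℂ] (K →L[ℂ] K) :=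
    { toFun := ρ
      -- `ψ_a` is not additive in `a`; additivity appears only after pairing, through the linearity
      -- of `T`.
      map_add' := fun a b => hρext _ _ fun f => hext _ _ fun g => by
        rw [add_apply, hρ, hρ, hρ, ← map_add, hform, hform,
          OpKernel.form_add_left, form_translation_left, form_translation_left,
          form_translation_left, ← Finsupp.sum_add]
        simp only [← Finsupp.sum_add]
        simp [mul_add, add_mul]
      map_smul' := fun c a => hρext _ _ fun f => hext _ _ fun g => by
        rw [RingHom.id_apply, smul_apply, hρ, hρ, map_smul, inner_smul_right,
          hform, hform, form_translation_left, form_translation_left]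
        simp [Finsupp.sum, Finset.mul_sum] }
  let π : A →ₐ[ℂ] (K →L[ℂ] K) := AlgHom.ofLinearMap ρl
    (hρext _ _ fun f => by
      change ρ 1 (q f) = q f
      rw [hρ, translation_one])
    (fun a b => hρext _ _ fun f => by
      change ρ (a * b) (q f) = ρ a (ρ b (q f))
      rw [hρ, hρ, hρ, translation_mul])
  have hπ : ∀ a f, π a (q f) = q (translation H starAction a f) := hρ
  obtain ⟨C, hC⟩ := hB
  let B : H →L[ℂ] K := (q ∘ₗ Finsupp.lsingle 1).mkContinuous C hC
  have hBq : ∀ ξ, B ξ = q (Finsupp.single 1 ξ) := fun ξ => rfl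
  have hπB : ∀ a ξ, π a (B ξ) = q (Finsupp.single (star a) ξ) := fun a ξ => by
    rw [hBq, hπ, translation_single, starAction, one_mul]
  refine ⟨K, inferInstance, inferInstance, inferInstance, inferInstance, ⟨B, π, ?_, ?_⟩, ?_⟩
  · intro a
    refine hρext _ _ fun f => hext _ _ fun g => ?_
    simp only [KreinSpace.sharp, ContinuousLinearMap.comp_apply]
    rw [J_apply_J_apply, adjoint_inner_right, hπ, hπ, hform, hform, form_translation_right]
  · intro a
    ext ξ
    refine ext_inner_left ℂ fun η => ?_
    simp only [ContinuousLinearMap.comp_apply]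
    rw [adjoint_inner_right, hπB, hBq, hform, OpKernel.form_single]
    simp [kernelOf]
  · rw [StinespringDilation.IsMinimal, ← Submodule.dense_iff_topologicalClosure_eq_top]
    refine hq.mono ?_
    rintro _ ⟨f, rfl⟩
    induction f using Finsupp.induction_linear with
    | zero => simp
    | add f g hf hg => rw [map_add]; exact add_mem hf hg
    | single x ξ => exact Submodule.subset_span ⟨star x, ξ, by rw [hπB, star_star]⟩

theorem hasMinimalStinespringDilation_of_le {T : A →ₗ[ℂ] (H →L[ℂ] H)} (hT : IsHermitianMap T)
    {L : OpKernel A H} (hL : L.IsPosDef) (hLb : L.IsBoundedFor (starAction (A := A)))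
    (h1 : OpKernel.Le (-L) (kernelOf T)) (h2 : (kernelOf T).Le L) :
    HasMinimalStinespringDilation T := by
  obtain ⟨F, _, _, _, κ, hκ, h⟩ := hL.exists_inner_eq_form
  obtain ⟨G, hG, hGf⟩ := (kernelOf_isHermitian hT).exists_gram hL h1 h2 hκ h
  obtain ⟨K, _, _, _, _, Q, hQ, hQG, hQU⟩ := exists_kreinSpace_of_isSelfAdjoint G hG
  have hbd : ∀ a, ∃ C : ℝ, ∀ f, ‖κ (translation H starAction a f)‖ ≤ C * ‖κ f‖ := fun a => by
    simpa only [norm_eq_seminorm_of_inner_eq_form h] using hLb a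
  let U : A → F →L[ℂ] F := fun a => (κ ∘ₗ translation H starAction a).extendOfNorm κ
  have hU : ∀ a f, U a (κ f) = κ (translation H starAction a f) := fun a f =>
    LinearMap.extendOfNorm_eq (f := κ ∘ₗ translation H starAction a) hκ (hbd a) f
  -- The invariance of `K_T`, transported to `F`, is the intertwining relation required by `hQU`.
  have hGU : ∀ a, G * U a = adjoint (U (star a)) * G := fun a => by
    refine ContinuousLinearMap.coeFn_injective
      (hκ.equalizer (ContinuousLinearMap.continuous _) (ContinuousLinearMap.continuous _)
        (funext fun f => ?_))
    refine hκ.eq_of_inner_right ℂ fun g => ?_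
    change inner ℂ (κ g) (G (U a (κ f))) = inner ℂ (κ g) (adjoint (U (star a)) (G (κ f)))
    rw [adjoint_inner_right, hU, hU, hGf, hGf, form_translation_right, star_star]
  refine hasMinimalStinespringDilation_of_denseRange (q := (Q : F →ₗ[ℂ] K) ∘ₗ κ)
    (hQ.comp hκ Q.continuous) (fun f g => ?_) ?_ (fun a => ?_)
  · exact (hQG _ _).trans (hGf f g)
  -- `‖κ ξ_1‖ ^ 2 = ⟨L(1,1)ξ, ξ⟩`.
  · refine ⟨‖Q‖ * √‖L 1 1‖, fun ξ => (Q.le_opNorm _).trans ?_⟩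
    rw [mul_assoc, norm_eq_seminorm_of_inner_eq_form h, OpKernel.seminorm, OpKernel.form_single]
    gcongr
    refine Real.sqrt_le_iff.2 ⟨by positivity, ?_⟩
    rw [mul_pow, Real.sq_sqrt (norm_nonneg _)]
    calc _ ≤ ‖ξ‖ * ‖L 1 1 ξ‖ := (Complex.re_le_norm _).trans (norm_inner_le_norm _ _)
      _ ≤ ‖ξ‖ * (‖L 1 1‖ * ‖ξ‖) := by gcongr; exact (L 1 1).le_opNorm ξ
      _ = _ := by ring
  · obtain ⟨C, hC⟩ := hQU (U a) _ (hGU a)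
    refine ⟨C, fun f => ?_⟩
    change ‖Q (κ (translation H starAction a f))‖ ≤ C * ‖Q (κ f)‖
    rw [← hU]
    exact hC _

omit [StarModule ℂ A] in
theorem StinespringDilation.exists_le {T : A →ₗ[ℂ] (H →L[ℂ] H)} {K : Type w}
    [NormedAddCommGroup K] [InnerProductSpace ℂ K] [CompleteSpace K] [KreinSpace K]
    (D : StinespringDilation T K) :
    ∃ L ∈ boundedPosDefKernels H (starAction (A := A)),
      OpKernel.Le (-L) (kernelOf T) ∧ OpKernel.Le (kernelOf T) L := by
  -- The star matches `φ(a,1) = a^*`: with it `K_T(x,y) = V(x)^* J V(y)`, and `L` is the same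
  -- expression without `J`.
  let V : A → H →L[ℂ] K := fun x => D.rep (star x) ∘L D.B
  let L : OpKernel A H := fun x y => adjoint (V x) ∘L V y
  let σ : (A →₀ H) →ₗ[ℂ] K := Finsupp.lsum ℂ fun x => (V x : H →ₗ[ℂ] K)
  have hσ : ∀ f, σ f = f.sum fun x ξ => V x ξ := fun f => rfl
  have hL : ∀ f g, L.form f g = inner ℂ (σ g) (σ f) := fun f g => by
    rw [OpKernel.form_eq_sum, hσ, hσ]
    simp only [Finsupp.sum, sum_inner]
    simp [inner_sum, L, adjoint_inner_right]
  have hT' : ∀ x y ξ η, inner ℂ η (T (x * star y) ξ) =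
      inner ℂ (V x η) (KreinSpace.J (V y ξ)) := fun x y ξ η => by
    rw [D.dilates, map_mul]
    have := D.rep_star (star x)
    rw [star_star] at this
    rw [this]
    simp only [KreinSpace.sharp, ContinuousLinearMap.comp_apply, FunLike.coe_mul_eq_comp,
      Function.comp_apply, V]
    rw [adjoint_inner_right, J_apply_J_apply, adjoint_inner_right]
  have hK : ∀ f g, (kernelOf T).form f g = inner ℂ (σ g) (KreinSpace.J (σ f)) := fun f g => by
    rw [OpKernel.form_eq_sum, hσ, hσ]
    simp only [Finsupp.sum, sum_inner]
    simp [inner_sum, kernelOf, hT']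
  have hLn : ∀ f, (L.form f f).re = ‖σ f‖ ^ 2 := fun f => by
    rw [hL, ← inner_self_eq_norm_sq (𝕜 := ℂ)]; rfl
  have habs : ∀ f, |((kernelOf T).form f f).re| ≤ (L.form f f).re := fun f => by
    rw [hK, hLn, sq]
    refine (Complex.abs_re_le_norm _).trans ((norm_inner_le_norm _ _).trans ?_)
    rw [norm_J_apply]
  refine ⟨L, ⟨⟨fun x y => ?_, fun f => ?_⟩, fun a => ⟨‖D.rep a‖, fun f => ?_⟩⟩, fun f => ?_,
    fun f => (abs_le.1 (habs f)).2⟩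
  · simp [L, adjoint_comp]
  · rw [hLn]; positivity
  · have hs : ∀ f, L.seminorm f = ‖σ f‖ := fun f => by
      rw [OpKernel.seminorm, hLn, Real.sqrt_sq (norm_nonneg _)]
    -- Since `(x a^*)^* = a x^*`, `σ` intertwines `ψ_a` with `π(a)`, so `‖π(a)‖` is a bound for
    -- `ψ_a`.
    have ht : σ (translation H starAction a f) = D.rep a (σ f) := by
      induction f using Finsupp.induction_linear with
      | zero => simp
      | add f g hf hg => simp only [map_add, hf, hg]
      | single x ξ =>
        rw [translation_single]
        simp [σ, V, starAction]
    rw [hs, hs, ht]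
    exact (D.rep a).le_opNorm _
  · rw [OpKernel.form_neg, Complex.neg_re]
    exact (abs_le.1 (habs f)).1

end Dilation

end KreinDilation

theorem mainTheorem7 {A : Type u} [Ring A] [StarRing A] [Algebra ℂ A] [StarModule ℂ A]
    {H : Type v} [NormedAddCommGroup H] [InnerProductSpace ℂ H] [CompleteSpace H]
    (T : A →ₗ[ℂ] (H →L[ℂ] H)) (hT : KreinDilation.IsHermitianMap T) :
    (∃ L ∈ KreinDilation.boundedPosDefKernels H (KreinDilation.starAction (A := A)),
        KreinDilation.OpKernel.Le (-L) (KreinDilation.kernelOf T) ∧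
          KreinDilation.OpKernel.Le (KreinDilation.kernelOf T) L) ↔
      KreinDilation.HasMinimalStinespringDilation T := by
  constructor
  · rintro ⟨L, ⟨hL, hLb⟩, h1, h2⟩
    exact KreinDilation.hasMinimalStinespringDilation_of_le hT hL hLb h1 h2
  · rintro ⟨K, _, _, _, _, D, -⟩
    exact D.exists_le
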